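/- Let $a,b,c$ be nonzero integers. For $n\ge 1$ write $[n]=\{1,\dots,n\}$ and $T([n])=\{(x,y,z)\in[n]^3 : ax+by+cz=0\}$. For a colouring $f:[n]\to\{-1,1\}$ let $\mu(f)$ be the proportion of the triples $(x,y,z)\in T([n])$ that are monochromatic, i.e. satisfy $f(x)=f(y)=f(z)$ (with $\mu(f)=0$ if $T([n])$ is empty), and let $\mu([n])=\min_{f:[n]\to\{-1,1\}}\mu(f)$. Then the equation $ax+by+cz=0$ is uncommon over $[n]$, that is, $$\limsup_{n\to\infty}\mu([n])<\tfrac14 .$$ Equivalently, there is a constant $\delta>0$, depending only on $a,b,c$, such that for all sufficiently large $n$ some 2-colouring of $[n]$ has a proportion of monochromatic solutions at most $\tfrac14-\delta$, where $\tfrac14$ is the probability that a solution with distinct entries is monochromatic under a uniformly random colouring. -/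

import Mathlib

open Filter

/-- `T_E(A)`: the vectors in `A^k` solving `a₁ x₁ + ⋯ + a_k x_k = 0`, where the equation `E` is
given by its vector of integer coefficients. -/
def solutions {k : ℕ} (a : Fin k → ℤ) (A : Finset ℤ) : Finset (Fin k → A) :=
  Finset.univ.filter fun x => ∑ i, a i * (x i : ℤ) = 0

/-- `M_E(f)`: the solutions that are monochromatic under the colouring `f : A → {-1, 1}`. -/
def monoSolutions {k : ℕ} (a : Fin k → ℤ) {A : Finset ℤ} (f : A → ℤˣ) : Finset (Fin k → A) :=
  (solutions a A).filter fun x => ∀ i j, f (x i) = f (x j)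

/-- `μ_E(f) = |M_E(f)| / |T_E(A)|`, the proportion of monochromatic solutions
(equal to `0` if there are no solutions at all). -/
noncomputable def monoProportion {k : ℕ} (a : Fin k → ℤ) {A : Finset ℤ} (f : A → ℤˣ) : ℝ :=
  ((monoSolutions a f).card : ℝ) / ((solutions a A).card : ℝ)

/-- `μ_E(A)`, the minimum of `μ_E(f)` over the (finitely many) colourings `f : A → {-1, 1}`. -/
noncomputable def minMonoProportion {k : ℕ} (a : Fin k → ℤ) (A : Finset ℤ) : ℝ :=
  Finset.univ.inf' Finset.univ_nonempty fun f : A → ℤˣ => monoProportion a f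

/-- The equation with coefficients `a` is uncommon over `[n] = {1, …, n}`:
`limsup_{n → ∞} μ_E([n])` is strictly less than `2^{1-k}`. -/
def UncommonOverIntervals {k : ℕ} (a : Fin k → ℤ) : Prop :=
  limsup (fun n : ℕ => minMonoProportion a (Finset.Icc 1 (n : ℤ))) atTop
    < (2 : ℝ) ^ (1 - (k : ℤ))

/-!
For signs `f(x)`, `f(y)`, `f(z)` one has
`4 · 1_{f(x) = f(y) = f(z)} = 1 + f(x) f(y) + f(y) f(z) + f(z) f(x)`, so the number of
monochromatic solutions is a quarter of the number of all solutions plus a quarter of a quadratic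
form in `f`, whose matrix `tripleWeight` counts the ways in which a pair of entries extends to a
solution in `[n]` (`four_mul_card_monoSolutions`). As there are at most `n²` solutions,
it suffices to find, for all large `n`, a colouring at which this form is at most `-δ n²`
(`monoProportion_le`, `uncommonOverIntervals_of_eventually`). Points may be left uncoloured, with
`f = 0`, because random signs there cost only the diagonal terms, which are `O(n)`
(`exists_units_quadForm_le`).

If all coefficients have the same sign there are no solutions. Otherwise the equation is
`a x + b y = c z` with `a, b, c > 0`, up to a permutation and a sign. Only multiples of `M = a b c`
are coloured, so that the weight of a pair becomes a sum of indicators of linear inequalities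
(`tripleWeight_add_swap`): it is a step function of the position, which is constant near most points
of the diagonal but jumps elsewhere. A positive semidefinite kernel cannot do that. Concretely, take
two intervals `V₁`, `V₂` close to each other and a shorter interval `U` such that the kernel is
constant on the square of `V₁ ∪ V₂` while it is larger on `U × V₁` than on `U × V₂`. The form
vanishes at `1_{V₁} - 1_{V₂}` up to diagonal terms of the right sign, and subtracting `1_U` makes it
negative of order `n²` (`exists_quadForm_le_neg`). If `c ≤ b` such a jump occurs along
the line `a u + b v = c n` (`hasNegativeColorings_of_le`), and the case `c ≤ a` is symmetric;
if `c > a, b` it occurs near the origin along `c v = a u` (`hasNegativeColorings_of_lt`).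
-/

/-! ### Quadratic forms and partial colourings -/

/-- The quadratic form with matrix `W` on `A`, evaluated at `g`. -/
def quadForm (W : ℤ → ℤ → ℤ) (A : Finset ℤ) (g : ℤ → ℤ) : ℤ :=
  ∑ x ∈ A, ∑ y ∈ A, g x * g y * W x y

theorem quadForm_congr {W : ℤ → ℤ → ℤ} {A : Finset ℤ} {g h : ℤ → ℤ} (H : ∀ x ∈ A, g x = h x) :
    quadForm W A g = quadForm W A h :=
  Finset.sum_congr rfl fun x hx => Finset.sum_congr rfl fun y hy => by rw [H x hx, H y hy]

theorem quadForm_add_add_quadForm_sub (W : ℤ → ℤ → ℤ) (A : Finset ℤ) (g d : ℤ → ℤ) :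
    quadForm W A (fun x => g x + d x) + quadForm W A (fun x => g x - d x)
      = 2 * quadForm W A g + 2 * quadForm W A d := by
  simp only [quadForm, Finset.mul_sum, ← Finset.sum_add_distrib]
  exact Finset.sum_congr rfl fun x _ => Finset.sum_congr rfl fun y _ => by ring

theorem quadForm_single (W : ℤ → ℤ → ℤ) (A : Finset ℤ) {x₀ : ℤ} (hx : x₀ ∈ A) :
    quadForm W A (fun x => if x = x₀ then 1 else 0) = W x₀ x₀ := by
  simp [quadForm, hx]

/-- The points of `s` can be coloured one at a time, by the better of the two signs; by
`quadForm_add_add_quadForm_sub` this costs at most the diagonal entry. -/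
theorem exists_fill_zeros {W : ℤ → ℤ → ℤ} {A : Finset ℤ} {C : ℤ} (hW : ∀ x, W x x ≤ C)
    (g : ℤ → ℤ) (s : Finset ℤ) (hsA : s ⊆ A) (hs : ∀ x ∈ s, g x = 0) :
    ∃ h : ℤ → ℤ, (∀ x ∈ s, h x = 1 ∨ h x = -1) ∧ (∀ x ∉ s, h x = g x) ∧
      quadForm W A h ≤ quadForm W A g + C * s.card := by
  induction s using Finset.induction_on with
  | empty => exact ⟨g, by simp, by simp, by simp⟩
  | insert x₀ s hx₀ ih =>
    obtain ⟨h, h1, h2, h3⟩ := ih (fun x hx => hsA (Finset.mem_insert_of_mem hx))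
      (fun x hx => hs x (Finset.mem_insert_of_mem hx))
    have hh : h x₀ = 0 := by rw [h2 x₀ hx₀, hs x₀ (Finset.mem_insert_self _ _)]
    have key := quadForm_add_add_quadForm_sub W A h (fun x => if x = x₀ then 1 else 0)
    rw [quadForm_single W A (hsA (Finset.mem_insert_self _ _))] at key
    have hC := hW x₀
    rw [Finset.card_insert_of_notMem hx₀]
    push_cast
    have out : ∀ x ∉ insert x₀ s, x ≠ x₀ ∧ x ∉ s := by
      intro x hx; simpa using hx
    by_cases hle : quadForm W A (fun x => h x + if x = x₀ then 1 else 0)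
        ≤ quadForm W A h + W x₀ x₀
    · refine ⟨_, ?_, ?_, hle.trans (by linarith)⟩
      · intro x hx
        by_cases e : x = x₀
        · subst e; simp [hh]
        · simpa [e] using h1 x (Finset.mem_of_mem_insert_of_ne hx e)
      · intro x hx
        simp [(out x hx).1, h2 x (out x hx).2]
    · refine ⟨fun x => h x - if x = x₀ then 1 else 0, ?_, ?_, by linarith⟩
      · intro x hx
        by_cases e : x = x₀
        · subst e; simp [hh]
        · simpa [e] using h1 x (Finset.mem_of_mem_insert_of_ne hx e)
      · intro x hx
        simp [(out x hx).1, h2 x (out x hx).2]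

/-- Rounding: a partial colouring (with `0` for uncoloured points) extends to a full colouring at a
cost that is linear in the size of `A`. Averaging over the two signs at an uncoloured point kills
every term of the form except the diagonal one. -/
theorem exists_units_quadForm_le {W : ℤ → ℤ → ℤ} {A : Finset ℤ} {C : ℤ} (hC : 0 ≤ C)
    (hW : ∀ x, W x x ≤ C) (g : ℤ → ℤ) (hg : ∀ x, g x = 0 ∨ g x = 1 ∨ g x = -1) :
    ∃ G : ℤ → ℤˣ, quadForm W A (fun x => (G x : ℤ)) ≤ quadForm W A g + C * A.card := by
  obtain ⟨h, h1, h2, h3⟩ := exists_fill_zeros hW g (A.filter fun x => g x = 0)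
    (Finset.filter_subset _ _) (by simp)
  refine ⟨fun x => if h x = 1 then 1 else -1, ?_⟩
  have : quadForm W A (fun x => (((if h x = 1 then 1 else -1 : ℤˣ)) : ℤ)) = quadForm W A h := by
    refine quadForm_congr fun x hx => ?_
    have : h x = 1 ∨ h x = -1 := by
      by_cases e : g x = 0
      · exact h1 x (by simp [hx, e])
      · rw [h2 x (by simp [e])]
        exact (hg x).resolve_left e
    rcases this with e | e <;> simp [e]
  rw [this]
  refine h3.trans ?_
  have : ((A.filter fun x => g x = 0).card : ℤ) ≤ A.card := by
    exact_mod_cast Finset.card_filter_le _ _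
  nlinarith

/-- A symmetric matrix that is constant on the square of `V₁ ∪ V₂` (up to a smaller diagonal) but
jumps between `U × V₁` and `U × V₂` has a negative direction `1_{V₁} - 1_{V₂} - 1_U`: the form is at
most `0` at `1_{V₁} - 1_{V₂}`, so the cross term with `1_U` decides. The ratio `4` of the sizes
makes the cross term `-8 |U|²` outweigh the bound `6 |U|²` for the form at `1_U`. -/
theorem exists_quadForm_le_neg {W : ℤ → ℤ → ℤ} {A U V₁ V₂ : Finset ℤ} {κ : ℤ}
    (hsymm : ∀ x y, W x y = W y x) (hU : U ⊆ A) (hV₁ : V₁ ⊆ A) (hV₂ : V₂ ⊆ A)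
    (hd : Disjoint V₁ V₂) (hd₁ : Disjoint U V₁) (hd₂ : Disjoint U V₂)
    (hc₁ : V₁.card = 4 * U.card) (hc₂ : V₂.card = 4 * U.card)
    (hW : ∀ x y, W x y ≤ 6)
    (hoff : ∀ x ∈ V₁ ∪ V₂, ∀ y ∈ V₁ ∪ V₂, x ≠ y → W x y = κ)
    (hdiag : ∀ x ∈ V₁ ∪ V₂, W x x ≤ κ)
    (hjump : ∀ u ∈ U, ∀ x ∈ V₁, ∀ y ∈ V₂, W u y + 1 ≤ W u x) :
    ∃ g : ℤ → ℤ, (∀ x, g x = 0 ∨ g x = 1 ∨ g x = -1) ∧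
      quadForm W A g ≤ -2 * (U.card : ℤ) ^ 2 := by
  set u : ℤ → ℤ := fun x => if x ∈ U then 1 else 0 with hu
  set v : ℤ → ℤ := fun x => (if x ∈ V₁ then 1 else 0) - (if x ∈ V₂ then 1 else 0) with hv
  have sumV : ∀ φ : ℤ → ℤ, ∑ x ∈ A, v x * φ x = ∑ x ∈ V₁, φ x - ∑ x ∈ V₂, φ x := by
    intro φ
    simp only [hv, sub_mul, ite_mul, one_mul, zero_mul, Finset.sum_sub_distrib,
      Finset.sum_ite_mem, Finset.inter_eq_right.2 hV₁, Finset.inter_eq_right.2 hV₂]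
  have sumU : ∀ φ : ℤ → ℤ, ∑ x ∈ A, u x * φ x = ∑ x ∈ U, φ x := by
    intro φ
    simp only [hu, ite_mul, one_mul, zero_mul, Finset.sum_ite_mem, Finset.inter_eq_right.2 hU]
  refine ⟨fun x => v x - u x, ?_, ?_⟩
  · intro x
    by_cases h1 : x ∈ V₁
    · simp [hu, hv, h1, Finset.disjoint_left.1 hd h1, Finset.disjoint_right.1 hd₁ h1]
    · by_cases h2 : x ∈ V₂
      · simp [hu, hv, h1, h2, Finset.disjoint_right.1 hd₂ h2]
      · by_cases h3 : x ∈ U <;> simp [hu, hv, h1, h2, h3]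
  have expand : quadForm W A (fun x => v x - u x)
      = quadForm W A v - 2 * (∑ x ∈ A, u x * ∑ y ∈ A, v y * W x y) + quadForm W A u := by
    have hswap : ∑ x ∈ A, ∑ y ∈ A, v x * u y * W x y = ∑ x ∈ A, u x * ∑ y ∈ A, v y * W x y := by
      rw [Finset.sum_comm]
      refine Finset.sum_congr rfl fun y _ => ?_
      rw [Finset.mul_sum]
      exact Finset.sum_congr rfl fun x _ => by rw [hsymm x y]; ring
    rw [two_mul]
    nth_rewrite 1 [← hswap]
    simp only [quadForm, Finset.mul_sum, ← Finset.sum_add_distrib, ← Finset.sum_sub_distrib]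
    exact Finset.sum_congr rfl fun x _ => Finset.sum_congr rfl fun y _ => by ring
  have hVV : quadForm W A v ≤ 0 := by
    have hsum : ∑ x ∈ A, v x = 0 := by
      have := sumV fun _ => 1
      simpa [hc₁, hc₂] using this
    have : quadForm W A v ≤ ∑ x ∈ A, ∑ y ∈ A, v x * v y * κ := by
      refine Finset.sum_le_sum fun x _ => Finset.sum_le_sum fun y _ => ?_
      have out : ∀ x, x ∉ V₁ ∪ V₂ → v x = 0 := by
        intro x hx
        simp only [Finset.mem_union, not_or] at hx
        simp [hv, hx.1, hx.2]
      by_cases hx : x ∈ V₁ ∪ V₂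
      · by_cases hy : y ∈ V₁ ∪ V₂
        · by_cases e : x = y
          · subst e
            exact mul_le_mul_of_nonneg_left (hdiag x hx) (mul_self_nonneg _)
          · rw [hoff x hx y hy e]
        · simp [out y hy]
      · simp [out x hx]
    refine this.trans (le_of_eq ?_)
    simp only [← Finset.sum_mul, ← Finset.mul_sum, hsum, mul_zero, zero_mul,
      Finset.sum_const_zero]
  have hUU : quadForm W A u ≤ 6 * (U.card : ℤ) ^ 2 := by
    have e : quadForm W A u = ∑ x ∈ U, ∑ y ∈ U, W x y := by
      rw [← sumU]
      refine Finset.sum_congr rfl fun x _ => ?_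
      rw [← sumU, Finset.mul_sum]
      exact Finset.sum_congr rfl fun y _ => by ring
    rw [e]
    calc ∑ x ∈ U, ∑ y ∈ U, W x y ≤ ∑ x ∈ U, ∑ y ∈ U, (6 : ℤ) :=
          Finset.sum_le_sum fun x _ => Finset.sum_le_sum fun y _ => hW x y
      _ = 6 * (U.card : ℤ) ^ 2 := by simp; ring
  have hUV : 4 * (U.card : ℤ) ^ 2 ≤ ∑ x ∈ A, u x * ∑ y ∈ A, v y * W x y := by
    rw [sumU]
    have : ∀ x ∈ U, 4 * (U.card : ℤ) ≤ ∑ y ∈ A, v y * W x y := by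
      intro x hx
      rw [sumV]
      have hpos : 0 < (U.card : ℤ) := by exact_mod_cast Finset.card_pos.2 ⟨x, hx⟩
      have h1 : ∑ y ∈ V₁, ∑ z ∈ V₂, (1 : ℤ) ≤ ∑ y ∈ V₁, ∑ z ∈ V₂, (W x y - W x z) :=
        Finset.sum_le_sum fun y hy => Finset.sum_le_sum fun z hz => by
          have := hjump x hx y hy z hz; linarith
      simp only [Finset.sum_sub_distrib, Finset.sum_const, hc₁, hc₂,
        nsmul_eq_mul, mul_one, ← Finset.mul_sum] at h1
      push_cast at h1
      rw [← mul_sub] at h1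
      exact le_of_mul_le_mul_left h1 (by linarith)
    calc 4 * (U.card : ℤ) ^ 2 = ∑ x ∈ U, 4 * (U.card : ℤ) := by simp; ring
      _ ≤ _ := Finset.sum_le_sum this
  rw [expand]
  linarith

/-! ### Monochromatic solutions and the quadratic form -/

/-- Indicator that `x` and `y`, placed at the coefficients `p` and `q`, extend to a solution of
`p x + q y + e z = 0` with `z ∈ [n]`. -/
noncomputable def pairWeight (p q e : ℤ) (n : ℕ) (x y : ℤ) : ℤ :=
  if ∃ z ∈ Finset.Icc (1 : ℤ) n, p * x + q * y + e * z = 0 then 1 else 0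

/-- The number of ways in which `(x, y)` occurs as a cyclically consecutive pair of entries of a
solution of `a x + b y + c z = 0` in `[n]`. -/
noncomputable def tripleWeight (a b c : ℤ) (n : ℕ) (x y : ℤ) : ℤ :=
  pairWeight a b c n x y + pairWeight b c a n x y + pairWeight c a b n x y

theorem pairWeight_le_one (p q e : ℤ) (n : ℕ) (x y : ℤ) : pairWeight p q e n x y ≤ 1 := by
  unfold pairWeight; split_ifs <;> simp

theorem tripleWeight_le_three (a b c : ℤ) (n : ℕ) (x y : ℤ) : tripleWeight a b c n x y ≤ 3 := by
  have h1 := pairWeight_le_one a b c n x y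
  have h2 := pairWeight_le_one b c a n x y
  have h3 := pairWeight_le_one c a b n x y
  unfold tripleWeight
  linarith

theorem pairWeight_swap (p q e : ℤ) (n : ℕ) (x y : ℤ) :
    pairWeight q p e n x y = pairWeight p q e n y x := by
  simp only [pairWeight, add_comm (q * x)]

theorem pairWeight_neg (p q e : ℤ) (n : ℕ) (x y : ℤ) :
    pairWeight (-p) (-q) (-e) n x y = pairWeight p q e n x y := by
  have : ∀ z, -p * x + -q * y + -e * z = 0 ↔ p * x + q * y + e * z = 0 := fun z => by
    constructor <;> intro h <;> linarith
  simp only [pairWeight, this]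

/-- Summation over the solutions by two of the three entries, in the order given by `σ`; the third
entry is determined because its coefficient is nonzero. -/
theorem sum_solutions_eq (v : Fin 3 → ℤ) (σ : Equiv.Perm (Fin 3)) (h : v (σ 2) ≠ 0) (n : ℕ)
    (φ : ℤ → ℤ → ℤ) :
    ∑ t ∈ solutions v (Finset.Icc 1 (n : ℤ)), φ (t (σ 0)) (t (σ 1))
      = ∑ x ∈ Finset.Icc 1 (n : ℤ), ∑ y ∈ Finset.Icc 1 (n : ℤ),
          φ x y * pairWeight (v (σ 0)) (v (σ 1)) (v (σ 2)) n x y := by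
  have hsol : ∀ t : Fin 3 → Finset.Icc 1 (n : ℤ), t ∈ solutions v (Finset.Icc 1 (n : ℤ)) ↔
      v (σ 0) * t (σ 0) + v (σ 1) * t (σ 1) + v (σ 2) * t (σ 2) = 0 := by
    intro t
    rw [solutions, Finset.mem_filter, ← Equiv.sum_comp σ, Fin.sum_univ_three]
    simp
  rw [← Finset.sum_product']
  simp only [pairWeight, mul_ite, mul_one, mul_zero]
  rw [← Finset.sum_filter]
  refine Finset.sum_nbij (fun t => ((t (σ 0) : ℤ), (t (σ 1) : ℤ))) ?_ ?_ ?_ fun _ _ => rfl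
  · intro t ht
    rw [hsol] at ht
    simp only [Finset.mem_filter, Finset.mem_product]
    exact ⟨⟨(t _).2, (t _).2⟩, _, (t _).2, ht⟩
  · intro s hs t ht hst
    rw [Finset.mem_coe, hsol] at hs ht
    simp only [Prod.mk.injEq] at hst
    have h2 : (s (σ 2) : ℤ) = t (σ 2) := by
      refine mul_left_cancel₀ h ?_
      rw [hst.1, hst.2] at hs
      linarith
    funext i
    obtain ⟨j, rfl⟩ := σ.surjective i
    apply Subtype.ext
    fin_cases j
    · exact hst.1
    · exact hst.2
    · exact h2
  · rintro ⟨x, y⟩ hxy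
    simp only [Finset.coe_filter, Set.mem_ofPred_eq, Finset.mem_product] at hxy
    obtain ⟨⟨hx, hy⟩, z, hz, e⟩ := hxy
    refine ⟨fun i => ![⟨x, hx⟩, ⟨y, hy⟩, ⟨z, hz⟩] (σ.symm i), ?_, by simp⟩
    rw [Finset.mem_coe, hsol]
    simpa using e

theorem card_solutions_le (v : Fin 3 → ℤ) (h : v 2 ≠ 0) (n : ℕ) :
    (solutions v (Finset.Icc 1 (n : ℤ))).card ≤ n ^ 2 := by
  have key := sum_solutions_eq v 1 h n fun _ _ => 1
  have : ((solutions v (Finset.Icc 1 (n : ℤ))).card : ℤ) ≤ (n : ℤ) ^ 2 := by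
    calc ((solutions v (Finset.Icc 1 (n : ℤ))).card : ℤ)
        = ∑ t ∈ solutions v (Finset.Icc 1 (n : ℤ)), (1 : ℤ) := by simp
      _ ≤ ∑ x ∈ Finset.Icc 1 (n : ℤ), ∑ y ∈ Finset.Icc 1 (n : ℤ), (1 : ℤ) := by
          rw [key]
          refine Finset.sum_le_sum fun x _ => Finset.sum_le_sum fun y _ => ?_
          rw [one_mul]
          exact pairWeight_le_one _ _ _ _ _ _
      _ = (n : ℤ) ^ 2 := by simp; ring
  exact_mod_cast this

/-- Expansion of the number of monochromatic solutions, from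
`4 · 1_{f(x) = f(y) = f(z)} = 1 + f(x) f(y) + f(y) f(z) + f(z) f(x)`. -/
theorem four_mul_card_monoSolutions {a b c : ℤ} (ha : a ≠ 0) (hb : b ≠ 0) (hc : c ≠ 0) (n : ℕ)
    (G : ℤ → ℤˣ) :
    4 * ((monoSolutions ![a, b, c] fun x : Finset.Icc 1 (n : ℤ) => G x).card : ℤ)
      = (solutions ![a, b, c] (Finset.Icc 1 (n : ℤ))).card
        + quadForm (tripleWeight a b c n) (Finset.Icc 1 (n : ℤ)) (fun x => (G x : ℤ)) := by
  have h01 := sum_solutions_eq ![a, b, c] 1 hc n fun x y => (G x : ℤ) * G y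
  have h12 := sum_solutions_eq ![a, b, c] (finRotate 3) ha n fun x y => (G x : ℤ) * G y
  have h20 := sum_solutions_eq ![a, b, c] (finRotate 3).symm hb n fun x y => (G x : ℤ) * G y
  have hq : quadForm (tripleWeight a b c n) (Finset.Icc 1 (n : ℤ)) (fun x => (G x : ℤ))
      = ∑ t ∈ solutions ![a, b, c] (Finset.Icc 1 (n : ℤ)),
        ((G (t 0) : ℤ) * G (t 1) + (G (t 1) : ℤ) * G (t 2) + (G (t 2) : ℤ) * G (t 0)) := by
    simp only [quadForm, tripleWeight, mul_add, Finset.sum_add_distrib]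
    exact congrArg₂ _ (congrArg₂ _ h01.symm h12.symm) h20.symm
  rw [hq, monoSolutions, Finset.card_eq_sum_ones, Finset.card_eq_sum_ones, Finset.sum_filter]
  push_cast
  rw [Finset.mul_sum, ← Finset.sum_add_distrib]
  refine Finset.sum_congr rfl fun t _ => ?_
  have : (∀ i j, G (t i) = G (t j)) ↔ G (t 0) = G (t 1) ∧ G (t 1) = G (t 2) := by
    constructor
    · exact fun h => ⟨h _ _, h _ _⟩
    · rintro ⟨h1, h2⟩ i j
      fin_cases i <;> fin_cases j <;> simp [h1, h2]
  simp only [this]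
  rcases Int.units_eq_one_or (G (t 0)) with h0 | h0 <;>
    rcases Int.units_eq_one_or (G (t 1)) with h1 | h1 <;>
    rcases Int.units_eq_one_or (G (t 2)) with h2 | h2 <;> simp [h0, h1, h2]

theorem monoProportion_le {a b c : ℤ} (ha : a ≠ 0) (hb : b ≠ 0) (hc : c ≠ 0) {n : ℕ} (hn : 0 < n)
    (G : ℤ → ℤˣ) {δ : ℝ} (hδ : 0 < δ)
    (h : (quadForm (tripleWeight a b c n) (Finset.Icc 1 (n : ℤ)) (fun x => (G x : ℤ)) : ℝ)
      ≤ -δ * (n : ℝ) ^ 2) :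
    monoProportion ![a, b, c] (fun x : Finset.Icc 1 (n : ℤ) => G x) ≤ 1 / 4 - δ / 4 := by
  have key : 4 * ((monoSolutions ![a, b, c] fun x : Finset.Icc 1 (n : ℤ) => G x).card : ℝ)
      = (solutions ![a, b, c] (Finset.Icc 1 (n : ℤ))).card
        + quadForm (tripleWeight a b c n) (Finset.Icc 1 (n : ℤ)) (fun x => (G x : ℤ)) := by
    exact_mod_cast four_mul_card_monoSolutions ha hb hc n G
  have hle : ((solutions ![a, b, c] (Finset.Icc 1 (n : ℤ))).card : ℝ) ≤ (n : ℝ) ^ 2 := by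
    exact_mod_cast card_solutions_le ![a, b, c] hc n
  have hn' : (0 : ℝ) < (n : ℝ) ^ 2 := by positivity
  have h0 : (0 : ℝ) ≤ (monoSolutions ![a, b, c] fun x : Finset.Icc 1 (n : ℤ) => G x).card := by
    positivity
  have hpos : (0 : ℝ) < (solutions ![a, b, c] (Finset.Icc 1 (n : ℤ))).card := by nlinarith
  rw [monoProportion, div_le_iff₀ hpos]
  nlinarith

theorem minMonoProportion_le {k : ℕ} (a : Fin k → ℤ) (A : Finset ℤ) (f : A → ℤˣ) :
    minMonoProportion a A ≤ monoProportion a f :=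
  Finset.inf'_le _ (Finset.mem_univ f)

theorem minMonoProportion_nonneg {k : ℕ} (a : Fin k → ℤ) (A : Finset ℤ) :
    0 ≤ minMonoProportion a A :=
  Finset.le_inf' _ _ fun f _ => by unfold monoProportion; positivity

theorem uncommonOverIntervals_of_eventually {a : Fin 3 → ℤ} {δ : ℝ} (hδ : 0 < δ)
    (h : ∀ᶠ n : ℕ in atTop, minMonoProportion a (Finset.Icc 1 (n : ℤ)) ≤ 1 / 4 - δ) :
    UncommonOverIntervals a := by
  unfold UncommonOverIntervals
  refine lt_of_le_of_lt (limsup_le_of_le ?_ h) ?_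
  · exact IsCoboundedUnder.of_frequently_ge (a := 0)
      (Eventually.of_forall fun n => minMonoProportion_nonneg _ _).frequently
  · norm_num
    exact hδ

/-! ### Blocks of multiples -/

/-- Indicator of `0 < L ≤ e n / M`: when `e ∣ M`, it tells whether the variable with coefficient
`e` lies in `[n]` when the other two variables are `M` times integers whose contribution to the
equation is `-M L`. -/
def rangeInd (M n e L : ℤ) : ℤ := if 0 < L ∧ M * L ≤ e * n then 1 else 0

theorem rangeInd_eq_one {M n e L : ℤ} (h0 : 0 < L) (h1 : M * L ≤ e * n) : rangeInd M n e L = 1 :=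
  if_pos ⟨h0, h1⟩

theorem rangeInd_eq_zero_of_nonpos {M n e L : ℤ} (h : L ≤ 0) : rangeInd M n e L = 0 :=
  if_neg fun h' => absurd h'.1 (not_lt.2 h)

theorem rangeInd_eq_zero_of_lt {M n e L : ℤ} (h : e * n < M * L) : rangeInd M n e L = 0 :=
  if_neg fun h' => absurd h'.2 (not_le.2 h)

theorem rangeInd_nonneg (M n e L : ℤ) : 0 ≤ rangeInd M n e L := by
  unfold rangeInd; split_ifs <;> simp

theorem rangeInd_le_one (M n e L : ℤ) : rangeInd M n e L ≤ 1 := by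
  unfold rangeInd; split_ifs <;> simp

theorem rangeInd_le {M n e L L' : ℤ} (h : 0 < L → M * L ≤ e * n → 0 < L' ∧ M * L' ≤ e * n) :
    rangeInd M n e L ≤ rangeInd M n e L' := by
  unfold rangeInd
  split_ifs with h1 h2
  · rfl
  · exact absurd (h h1.1 h1.2) h2
  · exact zero_le_one
  · rfl

theorem pairWeight_mul {M e : ℤ} (hM : 0 < M) (he : 0 < e) (hd : e ∣ M) (p q : ℤ) (n : ℕ)
    (k l : ℤ) : pairWeight p q e n (M * k) (M * l) = rangeInd M n e (-(p * k + q * l)) := by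
  obtain ⟨d, rfl⟩ := hd
  have hd : 0 < d := pos_of_mul_pos_right hM he.le
  unfold pairWeight rangeInd
  refine if_congr ?_ rfl rfl
  set L := -(p * k + q * l) with hL
  have hpos : 1 ≤ d * L ↔ 0 < L := by
    rw [← zero_add (1 : ℤ), Int.add_one_le_iff]
    exact ⟨fun h => pos_of_mul_pos_right h hd.le, fun h => mul_pos hd h⟩
  have hup : d * L ≤ n ↔ e * d * L ≤ e * n := by
    rw [mul_assoc]
    exact (mul_le_mul_iff_right₀ he).symm
  rw [← hpos, ← hup]
  constructor
  · rintro ⟨z, hz, h⟩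
    have : z = d * L := by
      refine mul_left_cancel₀ he.ne' ?_
      rw [hL]
      linear_combination h
    rw [← this]
    exact Finset.mem_Icc.1 hz
  · intro h
    exact ⟨d * L, Finset.mem_Icc.2 h, by rw [hL]; ring⟩

/-- The symmetrised weight of the pair `(M k, M l)` for the equation `a x + b y = c z`. -/
def blockWeight (a b c M n k l : ℤ) : ℤ :=
  (rangeInd M n c (a * k + b * l) + rangeInd M n c (a * l + b * k))
    + (rangeInd M n a (c * k - b * l) + rangeInd M n a (c * l - b * k))
    + (rangeInd M n b (c * k - a * l) + rangeInd M n b (c * l - a * k))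

/-- Restricting to multiples of `M` removes all divisibility conditions: the weight depends only on
linear inequalities. -/
theorem tripleWeight_add_swap {a b c M : ℤ} (ha : 0 < a) (hb : 0 < b) (hc : 0 < c) (hM : 0 < M)
    (hda : a ∣ M) (hdb : b ∣ M) (hdc : c ∣ M) (n : ℕ) (k l : ℤ) :
    tripleWeight a b (-c) n (M * k) (M * l) + tripleWeight a b (-c) n (M * l) (M * k)
      = blockWeight a b c M n k l := by
  have h (x y : ℤ) : pairWeight a b (-c) n x y = pairWeight (-a) (-b) c n x y := by
    rw [← pairWeight_neg, neg_neg]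
  have e1 (x y : ℤ) : -(-a * x + -b * y) = a * x + b * y := by ring
  have e2 (x y : ℤ) : -(b * x + -c * y) = c * y - b * x := by ring
  have e3 (x y : ℤ) : -(-c * x + a * y) = c * x - a * y := by ring
  simp only [tripleWeight, h, pairWeight_mul hM ha hda, pairWeight_mul hM hb hdb,
    pairWeight_mul hM hc hdc, e1, e2, e3, blockWeight]
  ring

/-- The multiples `M k` with `k ∈ (p m, q m]`. -/
noncomputable def block (M m p q : ℤ) : Finset ℤ := (Finset.Ioc (p * m) (q * m)).image (M * ·)

theorem card_block {M : ℤ} (hM : 0 < M) (m : ℕ) (p w : ℕ) :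
    (block M m p (p + w)).card = w * m := by
  rw [block, Finset.card_image_of_injective _ (mul_right_injective₀ hM.ne'), Int.card_Ioc]
  rw [← sub_mul, add_sub_cancel_left]
  exact_mod_cast Int.toNat_natCast (w * m)

theorem block_subset {M m p q D n : ℤ} (hM : 0 < M) (hm : 0 ≤ m) (hp : 0 ≤ p) (hq : q ≤ D)
    (hn : M * (D * m) ≤ n) : block M m p q ⊆ Finset.Icc 1 n := by
  intro x hx
  obtain ⟨k, hk, rfl⟩ := Finset.mem_image.1 hx
  rw [Finset.mem_Ioc] at hk
  have h0 : 0 < k := lt_of_le_of_lt (mul_nonneg hp hm) hk.1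
  have h1 : k ≤ D * m := hk.2.trans (mul_le_mul_of_nonneg_right hq hm)
  exact Finset.mem_Icc.2 ⟨Int.add_one_le_iff.2 (mul_pos hM h0),
    (mul_le_mul_of_nonneg_left h1 hM.le).trans hn⟩

theorem disjoint_block {M m p q p' q' : ℤ} (hM : 0 < M) (hm : 0 ≤ m) (h : q ≤ p') :
    Disjoint (block M m p q) (block M m p' q') := by
  rw [block, block, Finset.disjoint_image (mul_right_injective₀ hM.ne'), Finset.disjoint_left]
  intro k hk hk'
  rw [Finset.mem_Ioc] at hk hk'
  have := mul_le_mul_of_nonneg_right h hm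
  linarith

theorem quadForm_add_swap (W : ℤ → ℤ → ℤ) (A : Finset ℤ) (g : ℤ → ℤ) :
    quadForm (fun x y => W x y + W y x) A g = 2 * quadForm W A g := by
  have : quadForm (fun x y => W y x) A g = quadForm W A g := by
    unfold quadForm
    rw [Finset.sum_comm]
    exact Finset.sum_congr rfl fun x _ => Finset.sum_congr rfl fun y _ => by ring
  rw [two_mul]
  nth_rewrite 2 [← this]
  simp only [quadForm, mul_add, Finset.sum_add_distrib]

/-- `exists_quadForm_le_neg` for blocks of multiples of `M`, with one block `U` of width `m` and two
blocks `V₁`, `V₂` of width `4 m`, and the hypotheses in terms of `blockWeight`. -/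
theorem exists_quadForm_le_of_blocks {a b c M D κ : ℤ} (ha : 0 < a) (hb : 0 < b) (hc : 0 < c)
    (hM : 0 < M) (hda : a ∣ M) (hdb : b ∣ M) (hdc : c ∣ M) {m n : ℕ} {p p₁ p₂ : ℤ}
    (hp : 0 ≤ p) (hp₁ : 0 ≤ p₁) (hp₂ : 0 ≤ p₂) (hD : p + 1 ≤ D) (hD₁ : p₁ + 4 ≤ D)
    (hD₂ : p₂ + 4 ≤ D) (hn : M * (D * m) ≤ n)
    (hd : p₁ + 4 ≤ p₂ ∨ p₂ + 4 ≤ p₁) (hd₁ : p + 1 ≤ p₁ ∨ p₁ + 4 ≤ p)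
    (hd₂ : p + 1 ≤ p₂ ∨ p₂ + 4 ≤ p)
    (hV : ∀ k ∈ Finset.Ioc (p₁ * m) ((p₁ + 4) * m) ∪ Finset.Ioc (p₂ * m) ((p₂ + 4) * m),
      ∀ l ∈ Finset.Ioc (p₁ * m) ((p₁ + 4) * m) ∪ Finset.Ioc (p₂ * m) ((p₂ + 4) * m),
      blockWeight a b c M n k l ≤ κ ∧ (k ≠ l → blockWeight a b c M n k l = κ))
    (hjump : ∀ u ∈ Finset.Ioc (p * m) ((p + 1) * m), ∀ x ∈ Finset.Ioc (p₁ * m) ((p₁ + 4) * m),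
      ∀ y ∈ Finset.Ioc (p₂ * m) ((p₂ + 4) * m),
      blockWeight a b c M n u y + 1 ≤ blockWeight a b c M n u x) :
    ∃ g : ℤ → ℤ, (∀ x, g x = 0 ∨ g x = 1 ∨ g x = -1) ∧
      quadForm (tripleWeight a b (-c) n) (Finset.Icc 1 (n : ℤ)) g ≤ -(m : ℤ) ^ 2 := by
  have hm : (0 : ℤ) ≤ m := Int.natCast_nonneg m
  have disj {q r s t : ℤ} (h : r ≤ s ∨ t ≤ q) : Disjoint (block M m q r) (block M m s t) :=
    h.elim (disjoint_block hM hm) fun h => (disjoint_block hM hm h).symm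
  have card4 {q : ℤ} (hq : 0 ≤ q) : (block M m q (q + 4)).card = 4 * m := by
    lift q to ℕ using hq
    exact card_block hM m q 4
  have card1 : (block M m p (p + 1)).card = m := by
    lift p to ℕ using hp
    simpa using card_block hM m p 1
  have union : block M m p₁ (p₁ + 4) ∪ block M m p₂ (p₂ + 4)
      = (Finset.Ioc (p₁ * m) ((p₁ + 4) * m) ∪ Finset.Ioc (p₂ * m) ((p₂ + 4) * (m : ℤ))).image
        (M * ·) := Finset.image_union _ _ |>.symm
  obtain ⟨g, hg, hle⟩ := exists_quadForm_le_neg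
    (W := fun x y => tripleWeight a b (-c) n x y + tripleWeight a b (-c) n y x) (κ := κ)
    (A := Finset.Icc 1 (n : ℤ)) (U := block M m p (p + 1)) (V₁ := block M m p₁ (p₁ + 4))
    (V₂ := block M m p₂ (p₂ + 4)) (fun x y => add_comm _ _)
    (block_subset hM hm hp hD hn) (block_subset hM hm hp₁ hD₁ hn)
    (block_subset hM hm hp₂ hD₂ hn) (disj hd) (disj hd₁) (disj hd₂)
    (by rw [card4 hp₁, card1]) (by rw [card4 hp₂, card1])
    (fun x y => by
      have h1 := tripleWeight_le_three a b (-c) n x y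
      have h2 := tripleWeight_le_three a b (-c) n y x
      linarith)
    (by
      rw [union]
      intro x hx y hy hxy
      obtain ⟨k, hk, rfl⟩ := Finset.mem_image.1 hx
      obtain ⟨l, hl, rfl⟩ := Finset.mem_image.1 hy
      rw [tripleWeight_add_swap ha hb hc hM hda hdb hdc]
      exact (hV k hk l hl).2 fun h => hxy (by rw [h]))
    (by
      rw [union]
      intro x hx
      obtain ⟨k, hk, rfl⟩ := Finset.mem_image.1 hx
      rw [tripleWeight_add_swap ha hb hc hM hda hdb hdc]
      exact (hV k hk k hk).1)
    (by
      intro u hu x hx y hy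
      obtain ⟨k, hk, rfl⟩ := Finset.mem_image.1 hu
      obtain ⟨l, hl, rfl⟩ := Finset.mem_image.1 hx
      obtain ⟨r, hr, rfl⟩ := Finset.mem_image.1 hy
      rw [tripleWeight_add_swap ha hb hc hM hda hdb hdc,
        tripleWeight_add_swap ha hb hc hM hda hdb hdc]
      exact hjump k hk l hl r hr)
  refine ⟨g, hg, ?_⟩
  rw [quadForm_add_swap, card1] at hle
  linarith

/-- On a short interval `(A, B]`, the number of positive ones among `q k - p l` and `q l - p k` does
not depend on `k ≠ l`: the sign is that of `q - p`, and if `p = q` exactly one of them is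
positive. -/
theorem exists_rangeInd_add_swap_eq {M n e p q A B : ℤ} (hM : 0 < M) (hp : 0 < p) (hq : 0 < q)
    (hlt : q < p → q * B ≤ p * A) (hgt : p < q → p * B ≤ q * A)
    (hup : p ≤ q → M * (q * B - p * A) ≤ e * n) :
    ∃ κ, ∀ k l, A < k → k ≤ B → A < l → l ≤ B →
      rangeInd M n e (q * k - p * l) + rangeInd M n e (q * l - p * k) ≤ κ ∧
      (k ≠ l → rangeInd M n e (q * k - p * l) + rangeInd M n e (q * l - p * k) = κ) := by
  have upper (h : p ≤ q) (k l : ℤ) (hk : k ≤ B) (hl : A < l) : M * (q * k - p * l) ≤ e * n := by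
    refine le_trans (mul_le_mul_of_nonneg_left ?_ hM.le) (hup h)
    have h1 := mul_le_mul_of_nonneg_left hk hq.le
    have h2 := mul_le_mul_of_nonneg_left hl.le hp.le
    linarith
  rcases lt_trichotomy p q with h | rfl | h
  · have pos (k l : ℤ) (hk : A < k) (hl : l ≤ B) : 0 < q * k - p * l := by
      have h1 := mul_lt_mul_of_pos_left hk hq
      have h2 := mul_le_mul_of_nonneg_left hl hp.le
      have h3 := hgt h
      linarith
    refine ⟨2, fun k l hk hk' hl hl' => ?_⟩
    rw [rangeInd_eq_one (pos k l hk hl') (upper h.le k l hk' hl),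
      rangeInd_eq_one (pos l k hl hk') (upper h.le l k hl' hk)]
    simp
  · refine ⟨1, fun k l hk hk' hl hl' => ?_⟩
    rcases lt_trichotomy k l with hkl | rfl | hkl
    · have := mul_lt_mul_of_pos_left hkl hp
      rw [rangeInd_eq_one (L := p * l - p * k) (by linarith) (upper le_rfl l k hl' hk),
        rangeInd_eq_zero_of_nonpos (by linarith)]
      simp
    · rw [rangeInd_eq_zero_of_nonpos (by linarith)]
      simp
    · have := mul_lt_mul_of_pos_left hkl hp
      rw [rangeInd_eq_one (L := p * k - p * l) (by linarith) (upper le_rfl k l hk' hl),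
        rangeInd_eq_zero_of_nonpos (by linarith)]
      simp
  · have neg (k l : ℤ) (hk : k ≤ B) (hl : A < l) : q * k - p * l ≤ 0 := by
      have h1 := mul_le_mul_of_nonneg_left hk hq.le
      have h2 := mul_le_mul_of_nonneg_left hl.le hp.le
      have h3 := hlt h
      linarith
    refine ⟨0, fun k l hk hk' hl hl' => ?_⟩
    rw [rangeInd_eq_zero_of_nonpos (neg k l hk' hl), rangeInd_eq_zero_of_nonpos (neg l k hl' hk)]
    simp

/-! ### Partial colourings with a negative form -/

/-- For all large `n` there is a partial `±1`-colouring of `[n]` at which the quadratic form of the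
equation is at most `-m²`, where `m = ⌊n / K⌋` for a constant `K`. The value `0` marks uncoloured
points. -/
def HasNegativeColorings (a b c : ℤ) : Prop :=
  ∃ K m₀ : ℕ, 0 < K ∧ ∀ m n : ℕ, m₀ ≤ m → K * m ≤ n → n < K * (m + 1) →
    ∃ g : ℤ → ℤ, (∀ x, g x = 0 ∨ g x = 1 ∨ g x = -1) ∧
      quadForm (tripleWeight a b c n) (Finset.Icc 1 (n : ℤ)) g ≤ -(m : ℤ) ^ 2

/-- For `a x + b y = c z` with `c ≤ b`, the weight of `(u, v)` drops when `(u, v)` crosses the line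
`a u + b v = c n` with `u` small and `v` just below `c n / b`: the indicator of `z ≤ n` is lost,
while no other indicator increases. The weight is constant for both arguments near `c n / b`. -/
theorem hasNegativeColorings_of_le {a b c : ℤ} (ha : 0 < a) (hb : 0 < b) (hc : 0 < c)
    (hcb : c ≤ b) : HasNegativeColorings a b (-c) := by
  unfold HasNegativeColorings
  -- in units of `m`: `U = (5 b, 5 b + 1]`, `V₁ = (c E - R, c E - R + 4]`, `V₂ = (c E - 4, c E]`.
  -- `5 b` is large enough for `a u + b v` to exceed `c b E` on `U × V₂`, and `R` is large enough
  -- for it not to do so on `U × V₁`.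
  obtain ⟨R, hR⟩ : ∃ R, R = a * (5 * b + 1) + 4 := ⟨_, rfl⟩
  obtain ⟨E, hE⟩ : ∃ E, E = (a + b + c) * R + R + 1 := ⟨_, rfl⟩
  obtain ⟨M, hMdef⟩ : ∃ M, M = a * b * c := ⟨_, rfl⟩
  have hM : 0 < M := by rw [hMdef]; positivity
  have hda : a ∣ M := ⟨b * c, by rw [hMdef]; ring⟩
  have hdb : b ∣ M := ⟨a * c, by rw [hMdef]; ring⟩
  have hdc : c ∣ M := ⟨a * b, by rw [hMdef]; ring⟩
  have hab : 0 < a * b := mul_pos ha hb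
  have hbab : b ≤ a * b := le_mul_of_one_le_left hb.le ha
  have hRb : 5 * b + 5 ≤ R := by rw [hR]; linarith
  have hR0 : 0 < R := by linarith
  have hbR := mul_pos hb hR0
  have haR := mul_pos ha hR0
  have hcR := mul_pos hc hR0
  have hE0 : 0 < E := by rw [hE]; linarith
  have hcE : E ≤ c * E := le_mul_of_one_le_left hE0.le hc
  -- the lower end `c E - R` of the blocks around `c n / b` dominates everything of order `R`
  have hlow : (a + b + c) * R + 1 ≤ c * E - R := by linarith
  have hRaR : R ≤ a * R := le_mul_of_one_le_left hR0.le ha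
  have hX0 : 0 ≤ c * E - R := by linarith
  have haX : c * E - R ≤ a * (c * E - R) := le_mul_of_one_le_left hX0 ha
  have hbX : c * E - R ≤ b * (c * E - R) := le_mul_of_one_le_left hX0 hb
  have hcX : c * E - R ≤ c * (c * E - R) := le_mul_of_one_le_left hX0 hc
  have hcE0 : 0 ≤ c * E := by linarith
  have hcbE : c * E ≤ b * E := mul_le_mul_of_nonneg_right hcb hE0.le
  have hcc : c * (c * E) ≤ b * (b * E) := mul_le_mul hcb hcbE hcE0 hb.le
  have hb5 : b * (5 * b + 1) ≤ b * R := mul_le_mul_of_nonneg_left (by linarith) hb.le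
  have hc5 : c * (5 * b + 1) ≤ c * R := mul_le_mul_of_nonneg_left (by linarith) hc.le
  -- all three blocks lie in `(0, b E m]`, so `n ≈ M (b E) m`; `m ≥ c b E` absorbs the difference
  refine ⟨(M * (b * E)).toNat, (c * (b * E)).toNat, ?_, ?_⟩
  · rw [Int.lt_toNat]; positivity
  intro m n hm₀ hn hn'
  have hK : ((M * (b * E)).toNat : ℤ) = M * (b * E) := Int.toNat_of_nonneg (by positivity)
  have hm : c * (b * E) ≤ m := Int.toNat_le.1 hm₀
  have hmpos : (0 : ℤ) < m := lt_of_lt_of_le (by positivity) hm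
  have hn : M * (b * E * m) ≤ n := by
    have : (((M * (b * E)).toNat : ℤ)) * m ≤ n := by exact_mod_cast hn
    rw [hK] at this; linarith
  have hn' : (n : ℤ) < M * (b * E * (m + 1)) := by
    have : (n : ℤ) < ((M * (b * E)).toNat : ℤ) * (m + 1) := by exact_mod_cast hn'
    rw [hK] at this; linarith
  -- inequalities between block positions scale by `m`
  have scale {s t : ℤ} (h : s ≤ t) : s * m ≤ t * m := mul_le_mul_of_nonneg_right h hmpos.le
  have beyond {L : ℤ} (h : (c * (b * E) + 1) * m ≤ L) : c * (n : ℤ) < M * L := by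
    have h1 : c * (n : ℤ) < c * (M * (b * E * (m + 1))) := mul_lt_mul_of_pos_left hn' hc
    have h2 : M * (c * (b * E) * (m + 1)) ≤ M * L :=
      mul_le_mul_of_nonneg_left (by linarith) hM.le
    linarith
  have upto {e L : ℤ} (he : 0 < e) (h : L ≤ e * (b * E) * m) : M * L ≤ e * (n : ℤ) := by
    have h1 := mul_le_mul_of_nonneg_left hn he.le
    have h2 := mul_le_mul_of_nonneg_left h hM.le
    linarith
  have hV {k : ℤ} (hk : k ∈ Finset.Ioc ((c * E - R) * m) ((c * E - R + 4) * (m : ℤ))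
      ∪ Finset.Ioc ((c * E - 4) * m) ((c * E - 4 + 4) * (m : ℤ))) :
      (c * E - R) * m < k ∧ k ≤ c * E * m := by
    rw [Finset.mem_union, Finset.mem_Ioc, Finset.mem_Ioc] at hk
    rcases hk with hk | hk
    · exact ⟨hk.1, hk.2.trans (scale (by linarith))⟩
    · exact ⟨lt_of_le_of_lt (scale (by linarith)) hk.1, hk.2.trans (scale (by linarith))⟩
  obtain ⟨κ₁, h₁⟩ := exists_rangeInd_add_swap_eq (M := M) (n := n) (e := a) (p := b) (q := c)
    (A := (c * E - R) * m) (B := c * E * m) hM hb hc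
    (fun h => by
      have := mul_le_mul_of_nonneg_right (Int.add_one_le_iff.2 h) hcE0
      have : c * (c * E) ≤ b * (c * E - R) := by linarith
      have := scale this
      linarith)
    (fun h => absurd h (not_lt.2 hcb))
    (fun h => by
      obtain rfl : b = c := le_antisymm h hcb
      refine upto ha ?_
      have := le_mul_of_one_le_left hE0.le hab
      have : b * (b * E) - b * (b * E - R) ≤ a * (b * E) := by linarith
      have := scale this
      linarith)
  obtain ⟨κ₂, h₂⟩ := exists_rangeInd_add_swap_eq (M := M) (n := n) (e := b) (p := a) (q := c)
    (A := (c * E - R) * m) (B := c * E * m) hM ha hc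
    (fun h => by
      have := mul_le_mul_of_nonneg_right (Int.add_one_le_iff.2 h) hcE0
      have : c * (c * E) ≤ a * (c * E - R) := by linarith
      have := scale this
      linarith)
    (fun h => by
      have := mul_le_mul_of_nonneg_right (Int.add_one_le_iff.2 h) hcE0
      have : a * (c * E) ≤ c * (c * E - R) := by linarith
      have := scale this
      linarith)
    (fun h => by
      refine upto hb ?_
      have : c * (c * E) - a * (c * E - R) ≤ b * (b * E) := by linarith
      have := scale this
      linarith)
  have h₀ {k l : ℤ} (hk : (c * E - R) * m < k) (hl : (c * E - R) * m < l) :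
      rangeInd M n c (a * k + b * l) = 0 := by
    refine rangeInd_eq_zero_of_lt (beyond ?_)
    have : c * (b * E) + 1 ≤ a * (c * E - R) + b * (c * E - R) := by linarith
    have := scale this
    have h1 := mul_le_mul_of_nonneg_left hk.le ha.le
    have h2 := mul_le_mul_of_nonneg_left hl.le hb.le
    linarith
  refine exists_quadForm_le_of_blocks (D := b * E) (κ := κ₁ + κ₂) (p := 5 * b) (p₁ := c * E - R)
    (p₂ := c * E - 4) ha hb hc hM hda hdb hdc (by linarith) (by linarith) (by linarith)
    (by linarith) (by linarith) (by linarith) hn (Or.inl (by linarith)) (Or.inl (by linarith))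
    (Or.inl (by linarith)) ?_ ?_
  · intro k hk l hl
    obtain ⟨hk, hk'⟩ := hV hk
    obtain ⟨hl, hl'⟩ := hV hl
    have e1 := h₁ k l hk hk' hl hl'
    have e2 := h₂ k l hk hk' hl hl'
    rw [blockWeight, h₀ hk hl, h₀ hl hk]
    exact ⟨by linarith [e1.1, e2.1], fun h => by rw [e1.2 h, e2.2 h]; ring⟩
  · intro u hu x hx y hy
    obtain ⟨hxl, hxr⟩ := hV (Finset.mem_union_left _ hx)
    obtain ⟨hyl, hyr⟩ := hV (Finset.mem_union_right _ hy)
    rw [Finset.mem_Ioc] at hu hx hy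
    have hxy : x ≤ y := by
      have := scale (show c * E - R + 4 ≤ c * E - 4 by linarith)
      linarith
    have hu0 : 0 < u := lt_of_le_of_lt (by positivity) hu.1
    have au := mul_le_mul_of_nonneg_left hu.2 ha.le
    have bu := mul_le_mul_of_nonneg_left hu.2 hb.le
    have cu := mul_le_mul_of_nonneg_left hu.2 hc.le
    have ax := mul_le_mul_of_nonneg_left hxy ha.le
    have bx := mul_le_mul_of_nonneg_left hxy hb.le
    have cx := mul_le_mul_of_nonneg_left hxy hc.le
    have ax' := mul_le_mul_of_nonneg_left hxl.le ha.le
    have bx' := mul_le_mul_of_nonneg_left hxl.le hb.le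
    have cx' := mul_lt_mul_of_pos_left hxl hc
    have t1 : rangeInd M n c (a * u + b * y) = 0 := by
      refine rangeInd_eq_zero_of_lt (beyond ?_)
      have h1 := mul_le_mul_of_nonneg_left hu.1.le ha.le
      have h2 := mul_le_mul_of_nonneg_left hy.1.le hb.le
      have : c * (b * E) + 1 ≤ a * (5 * b) + b * (c * E - 4) := by linarith
      have := scale this
      linarith
    have t1' : rangeInd M n c (a * u + b * x) = 1 := by
      refine rangeInd_eq_one ?_ (upto hc ?_)
      · have : 0 ≤ b * ((c * E - R) * m) :=
          mul_nonneg hb.le (mul_nonneg (by linarith) hmpos.le)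
        have := mul_pos ha hu0
        linarith
      · have h2 := mul_le_mul_of_nonneg_left hx.2 hb.le
        have : a * (5 * b + 1) + b * (c * E - R + 4) ≤ c * (b * E) := by
          have := le_mul_of_one_le_left (show 0 ≤ R - 4 by linarith) hb
          linarith
        have := scale this
        linarith
    have t2 : rangeInd M n c (a * y + b * u) ≤ rangeInd M n c (a * x + b * u) := by
      refine rangeInd_le fun _ h => ⟨?_, le_trans (mul_le_mul_of_nonneg_left ?_ hM.le) h⟩
      · have : 0 ≤ a * ((c * E - R) * m) :=
          mul_nonneg ha.le (mul_nonneg (by linarith) hmpos.le)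
        have := mul_pos hb hu0
        linarith
      · linarith
    have t3 : rangeInd M n a (c * u - b * y) = 0 := by
      refine rangeInd_eq_zero_of_nonpos ?_
      have : c * (5 * b + 1) ≤ b * (c * E - R) := by linarith
      have := scale this
      linarith
    have t4 : rangeInd M n a (c * y - b * u) ≤ rangeInd M n a (c * x - b * u) := by
      refine rangeInd_le fun _ h => ⟨?_, le_trans (mul_le_mul_of_nonneg_left ?_ hM.le) h⟩
      · have : b * (5 * b + 1) ≤ c * (c * E - R) := by linarith
        have := scale this
        linarith
      · linarith
    have t5 : rangeInd M n b (c * u - a * y) = 0 := by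
      refine rangeInd_eq_zero_of_nonpos ?_
      have : c * (5 * b + 1) ≤ a * (c * E - R) := by linarith
      have := scale this
      linarith
    have t6 : rangeInd M n b (c * x - a * u) = 1 := by
      refine rangeInd_eq_one ?_ (upto hb ?_)
      · have : a * (5 * b + 1) ≤ c * (c * E - R) := by linarith
        have := scale this
        linarith
      · have h1 := mul_le_mul_of_nonneg_left hxr hc.le
        have : c * (c * E) ≤ b * (b * E) := by linarith
        have := scale this
        have := mul_pos ha hu0
        linarith
    have t3' := rangeInd_nonneg M n a (c * u - b * x)
    have t5' := rangeInd_nonneg M n b (c * u - a * x)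
    have t6' := rangeInd_le_one M n b (c * y - a * u)
    rw [blockWeight, blockWeight, t1, t1', t3, t5, t6]
    linarith

/-- For `a x + b y = c z` with `c` larger than `a` and `b`, all entries can be taken so small that
only positivity of the third variable matters. The weight is then maximal near the diagonal, and the
weight of `(u, v)` drops when `v` falls below `a u / c`, where `b y = c v - a u` changes sign. -/
theorem hasNegativeColorings_of_lt {a b c : ℤ} (ha : 0 < a) (hb : 0 < b) (hac : a < c)
    (hbc : b < c) : HasNegativeColorings a b (-c) := by
  unfold HasNegativeColorings
  have hc : 0 < c := ha.trans hac
  -- in units of `m`: `U = (c T, c T + 1]`, `V₁ = (a T + a, a T + a + 4]`, `V₂ = (a T - 4, a T]`,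
  -- on the two sides of the slope `a / c`; a large `T` makes the blocks thin compared to their
  -- distance from `0`, and `Z` bounds all of them.
  obtain ⟨T, hT⟩ : ∃ T, T = (a + b + c) * (a + 4) := ⟨_, rfl⟩
  obtain ⟨Z, hZ⟩ : ∃ Z, Z = c * T + a * T + a + 4 := ⟨_, rfl⟩
  obtain ⟨M, hMdef⟩ : ∃ M, M = a * b * c := ⟨_, rfl⟩
  have hM : 0 < M := by rw [hMdef]; positivity
  have hda : a ∣ M := ⟨b * c, by rw [hMdef]; ring⟩
  have hdb : b ∣ M := ⟨a * c, by rw [hMdef]; ring⟩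
  have hdc : c ∣ M := ⟨a * b, by rw [hMdef]; ring⟩
  have hT1 : a * (a + 4) + b * (a + 4) + c * (a + 4) = T := by rw [hT]; ring
  have pa : 0 < a * (a + 4) := by positivity
  have pb : 0 < b * (a + 4) := by positivity
  have pc : 0 < c * a := by positivity
  have hT0 : 0 < T := by linarith
  have hcT0 : 0 < c * T := mul_pos hc hT0
  have haT : T ≤ a * T := le_mul_of_one_le_left hT0.le ha
  have hacT : (a + 1) * T ≤ c * T := mul_le_mul_of_nonneg_right hac hT0.le
  have haaT : (a + 1) * (a * T) ≤ c * (a * T) :=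
    mul_le_mul_of_nonneg_right hac (mul_pos ha hT0).le
  have hbaT : (b + 1) * (a * T) ≤ c * (a * T) :=
    mul_le_mul_of_nonneg_right hbc (mul_pos ha hT0).le
  have hccT : c * ((a + 1) * T) ≤ c * (c * T) := mul_le_mul_of_nonneg_left hacT hc.le
  have hca : a ≤ c * a := le_mul_of_one_le_left ha.le hc
  have hT4 : a + 5 ≤ T := by
    have := le_mul_of_one_le_left (show 0 ≤ a + 4 by linarith) ha
    linarith
  have hZ0 : 0 < Z := by linarith
  have hDZ : Z ≤ (a + b + c) * Z := le_mul_of_one_le_left hZ0.le (by linarith)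
  refine ⟨(M * ((a + b + c) * Z)).toNat, 1, ?_, ?_⟩
  · rw [Int.lt_toNat]; positivity
  intro m n hm₀ hn _
  have hK : ((M * ((a + b + c) * Z)).toNat : ℤ) = M * ((a + b + c) * Z) :=
    Int.toNat_of_nonneg (by positivity)
  have hmpos : (0 : ℤ) < m := by exact_mod_cast hm₀
  have hn : M * ((a + b + c) * Z * m) ≤ n := by
    have : (((M * ((a + b + c) * Z)).toNat : ℤ)) * m ≤ n := by exact_mod_cast hn
    rw [hK] at this; linarith
  have scale {s t : ℤ} (h : s ≤ t) : s * m ≤ t * m := mul_le_mul_of_nonneg_right h hmpos.le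
  have hZm : 0 < Z * m := mul_pos hZ0 hmpos
  -- all the upper bounds hold, as the blocks are close to `0` compared to `n`
  have upto {e L : ℤ} (he : 0 < e) (h : L ≤ (a + b + c) * (Z * m)) : M * L ≤ e * (n : ℤ) := by
    have h2 := mul_le_mul_of_nonneg_left h hM.le
    have h3 : (n : ℤ) ≤ e * n := le_mul_of_one_le_left (Int.natCast_nonneg n) he
    linarith
  have hV {k : ℤ} (hk : k ∈ Finset.Ioc ((a * T + a) * m) ((a * T + a + 4) * (m : ℤ))
      ∪ Finset.Ioc ((a * T - 4) * m) ((a * T - 4 + 4) * (m : ℤ))) :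
      (a * T - 4) * m < k ∧ k ≤ (a * T + a + 4) * m := by
    rw [Finset.mem_union, Finset.mem_Ioc, Finset.mem_Ioc] at hk
    rcases hk with hk | hk
    · exact ⟨lt_of_le_of_lt (scale (by linarith)) hk.1, hk.2⟩
    · exact ⟨hk.1, hk.2.trans (scale (by linarith))⟩
  have pos4 : 0 ≤ (a * T - 4) * m := mul_nonneg (by linarith) hmpos.le
  have leZ : (a * T + a + 4) * m ≤ Z * m := scale (by rw [hZ]; linarith)
  have hup {p q e k l : ℤ} (he : 0 < e) (hp : 0 < p) (hq : 0 < q) (hpq : p + q ≤ a + b + c)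
      (hk : k ≤ Z * m) (hl : l ≤ Z * m) : M * (p * k + q * l) ≤ e * (n : ℤ) := by
    refine upto he ?_
    have h1 := mul_le_mul_of_nonneg_left hk hp.le
    have h2 := mul_le_mul_of_nonneg_left hl hq.le
    have h3 := mul_le_mul_of_nonneg_right hpq hZm.le
    linarith
  have hup' {p q e k l : ℤ} (he : 0 < e) (hp : 0 < p) (hq : 0 ≤ q) (hpq : p ≤ a + b + c)
      (hk : k ≤ Z * m) (hl : 0 ≤ l) : M * (p * k - q * l) ≤ e * (n : ℤ) := by
    refine upto he ?_
    have h1 := mul_le_mul_of_nonneg_left hk hp.le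
    have h2 := mul_nonneg hq hl
    have h3 := mul_le_mul_of_nonneg_right hpq hZm.le
    linarith
  obtain ⟨κ₁, h₁⟩ := exists_rangeInd_add_swap_eq (M := M) (n := n) (e := a) (p := b) (q := c)
    (A := (a * T - 4) * m) (B := (a * T + a + 4) * m) hM hb hc
    (fun h => absurd h hbc.not_gt)
    (fun _ => by
      have : b * (a * T + a + 4) ≤ c * (a * T - 4) := by linarith
      have := scale this
      linarith)
    (fun _ => hup' ha hc hb.le (by linarith) leZ pos4)
  obtain ⟨κ₂, h₂⟩ := exists_rangeInd_add_swap_eq (M := M) (n := n) (e := b) (p := a) (q := c)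
    (A := (a * T - 4) * m) (B := (a * T + a + 4) * m) hM ha hc
    (fun h => absurd h hac.not_gt)
    (fun _ => by
      have : a * (a * T + a + 4) ≤ c * (a * T - 4) := by linarith
      have := scale this
      linarith)
    (fun _ => hup' hb hc ha.le (by linarith) leZ pos4)
  have h₀ {k l : ℤ} (hk : 0 < k) (hl : 0 < l) (hk' : k ≤ Z * m) (hl' : l ≤ Z * m) :
      rangeInd M n c (a * k + b * l) = 1 :=
    rangeInd_eq_one (add_pos (mul_pos ha hk) (mul_pos hb hl))
      (hup hc ha hb (by linarith) hk' hl')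
  refine exists_quadForm_le_of_blocks (D := (a + b + c) * Z) (κ := 2 + κ₁ + κ₂) (p := c * T)
    (p₁ := a * T + a) (p₂ := a * T - 4) ha hb hc hM hda hdb hdc (by linarith) (by linarith)
    (by linarith) (by linarith) (by linarith) (by linarith) hn (Or.inr (by linarith))
    (Or.inr (by linarith)) (Or.inr (by linarith)) ?_ ?_
  · intro k hk l hl
    obtain ⟨hk, hk'⟩ := hV hk
    obtain ⟨hl, hl'⟩ := hV hl
    have e1 := h₁ k l hk hk' hl hl'
    have e2 := h₂ k l hk hk' hl hl'
    have k0 := pos4.trans_lt hk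
    have l0 := pos4.trans_lt hl
    rw [blockWeight, h₀ k0 l0 (hk'.trans leZ) (hl'.trans leZ),
      h₀ l0 k0 (hl'.trans leZ) (hk'.trans leZ)]
    exact ⟨by linarith [e1.1, e2.1], fun h => by rw [e1.2 h, e2.2 h]; ring⟩
  · intro u hu x hx y hy
    obtain ⟨hxl, hxr⟩ := hV (Finset.mem_union_left _ hx)
    obtain ⟨hyl, hyr⟩ := hV (Finset.mem_union_right _ hy)
    rw [Finset.mem_Ioc] at hu hx hy
    have hyx : y ≤ x := by
      have := scale (show a * T - 4 + 4 ≤ a * T + a by linarith)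
      linarith
    have x0 := pos4.trans_lt hxl
    have hu0 : 0 < u := lt_of_le_of_lt (by positivity) hu.1
    have uZ : u ≤ Z * m := hu.2.trans (scale (by rw [hZ]; linarith))
    have xZ := hxr.trans leZ
    have cu := mul_lt_mul_of_pos_left hu.1 hc
    have au := mul_lt_mul_of_pos_left hu.1 ha
    have au' := mul_le_mul_of_nonneg_left hu.2 ha.le
    have bx := mul_le_mul_of_nonneg_left hxr hb.le
    have ax := mul_le_mul_of_nonneg_left hxr ha.le
    have cxy := mul_le_mul_of_nonneg_left hyx hc.le
    have t4 : rangeInd M n a (c * y - b * u) ≤ rangeInd M n a (c * x - b * u) :=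
      rangeInd_le fun h _ => ⟨by linarith, hup' ha hc hb.le (by linarith) xZ hu0.le⟩
    have t3 : rangeInd M n a (c * u - b * x) = 1 := by
      refine rangeInd_eq_one ?_ (hup' ha hc hb.le (by linarith) uZ x0.le)
      have : b * (a * T + a + 4) ≤ c * (c * T) := by linarith
      have := scale this
      linarith
    have t5 : rangeInd M n b (c * u - a * x) = 1 := by
      refine rangeInd_eq_one ?_ (hup' hb hc ha.le (by linarith) uZ x0.le)
      have : a * (a * T + a + 4) ≤ c * (c * T) := by linarith
      have := scale this
      linarith
    have t6 : rangeInd M n b (c * x - a * u) = 1 := by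
      refine rangeInd_eq_one ?_ (hup' hb hc ha.le (by linarith) xZ hu0.le)
      have h1 := mul_lt_mul_of_pos_left hx.1 hc
      have : a * (c * T + 1) ≤ c * (a * T + a) := by linarith
      have := scale this
      linarith
    have t6' : rangeInd M n b (c * y - a * u) = 0 := by
      refine rangeInd_eq_zero_of_nonpos ?_
      have h1 := mul_le_mul_of_nonneg_left hy.2 hc.le
      linarith
    have t3' := rangeInd_le_one M n a (c * u - b * y)
    have t5' := rangeInd_le_one M n b (c * u - a * y)
    have t1 := rangeInd_le_one M n c (a * u + b * y)
    have t2 := rangeInd_le_one M n c (a * y + b * u)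
    rw [blockWeight, blockWeight, h₀ hu0 x0 uZ xZ, h₀ x0 hu0 xZ uZ, t3, t5, t6, t6']
    linarith

/-! ### Symmetries and the conclusion -/

theorem quadForm_tripleWeight_rotate (a b c : ℤ) (n : ℕ) (A : Finset ℤ) (g : ℤ → ℤ) :
    quadForm (tripleWeight b c a n) A g = quadForm (tripleWeight a b c n) A g := by
  have : tripleWeight b c a n = tripleWeight a b c n := by
    funext x y
    unfold tripleWeight
    ring
  rw [this]

theorem quadForm_tripleWeight_swap (a b c : ℤ) (n : ℕ) (A : Finset ℤ) (g : ℤ → ℤ) :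
    quadForm (tripleWeight b a c n) A g = quadForm (tripleWeight a b c n) A g := by
  unfold quadForm
  rw [Finset.sum_comm]
  refine Finset.sum_congr rfl fun x _ => Finset.sum_congr rfl fun y _ => ?_
  have : tripleWeight b a c n y x = tripleWeight a b c n x y := by
    unfold tripleWeight
    rw [pairWeight_swap, pairWeight_swap c a, pairWeight_swap b c]
    ring
  rw [this]
  ring

theorem quadForm_tripleWeight_neg (a b c : ℤ) (n : ℕ) (A : Finset ℤ) (g : ℤ → ℤ) :
    quadForm (tripleWeight (-a) (-b) (-c) n) A g = quadForm (tripleWeight a b c n) A g := by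
  simp only [quadForm, tripleWeight, pairWeight_neg]

theorem hasNegativeColorings_rotate {a b c : ℤ} :
    HasNegativeColorings b c a ↔ HasNegativeColorings a b c := by
  simp only [HasNegativeColorings, quadForm_tripleWeight_rotate]

theorem hasNegativeColorings_swap {a b c : ℤ} :
    HasNegativeColorings b a c ↔ HasNegativeColorings a b c := by
  simp only [HasNegativeColorings, quadForm_tripleWeight_swap a b]

theorem hasNegativeColorings_neg {a b c : ℤ} :
    HasNegativeColorings (-a) (-b) (-c) ↔ HasNegativeColorings a b c := by
  simp only [HasNegativeColorings, quadForm_tripleWeight_neg]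

theorem hasNegativeColorings_of_pos_pos_neg {a b c : ℤ} (ha : 0 < a) (hb : 0 < b) (hc : c < 0) :
    HasNegativeColorings a b c := by
  rw [← neg_neg c]
  have hc' : 0 < -c := neg_pos.2 hc
  by_cases h1 : -c ≤ b
  · exact hasNegativeColorings_of_le ha hb hc' h1
  · by_cases h2 : -c ≤ a
    · exact hasNegativeColorings_swap.1 (hasNegativeColorings_of_le hb ha hc' h2)
    · exact hasNegativeColorings_of_lt ha hb (not_le.1 h2) (not_le.1 h1)

theorem hasNegativeColorings_of_pos {a b c : ℤ} (ha : 0 < a) (hb : b ≠ 0) (hc : c ≠ 0)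
    (h : b < 0 ∨ c < 0) : HasNegativeColorings a b c := by
  rcases hb.lt_or_gt with hb | hb <;> rcases hc.lt_or_gt with hc | hc
  · rw [← hasNegativeColorings_neg, ← hasNegativeColorings_rotate]
    exact hasNegativeColorings_of_pos_pos_neg (neg_pos.2 hb) (neg_pos.2 hc) (neg_neg_of_pos ha)
  · rw [hasNegativeColorings_rotate.symm, hasNegativeColorings_rotate.symm]
    exact hasNegativeColorings_of_pos_pos_neg hc ha hb
  · exact hasNegativeColorings_of_pos_pos_neg ha hb hc
  · rcases h with h | h <;> exact absurd h (by linarith)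

theorem solutions_eq_empty_of_pos {v : Fin 3 → ℤ} (hv : ∀ i, 0 < v i) (n : ℕ) :
    solutions v (Finset.Icc 1 (n : ℤ)) = ∅ := by
  refine Finset.filter_eq_empty_iff.2 fun x _ => ne_of_gt ?_
  exact Finset.sum_pos (fun i _ => mul_pos (hv i) (Finset.mem_Icc.1 (x i).2).1)
    Finset.univ_nonempty

theorem solutions_neg {k : ℕ} (v : Fin k → ℤ) (A : Finset ℤ) :
    solutions (-v) A = solutions v A := by
  simp [solutions]

theorem uncommonOverIntervals_of_solutions_eq_empty {v : Fin 3 → ℤ}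
    (h : ∀ n : ℕ, solutions v (Finset.Icc 1 (n : ℤ)) = ∅) : UncommonOverIntervals v := by
  refine uncommonOverIntervals_of_eventually (δ := 1 / 8) (by norm_num)
    (Eventually.of_forall fun n => (minMonoProportion_le _ _ 1).trans ?_)
  rw [monoProportion, h]
  norm_num

theorem HasNegativeColorings.uncommonOverIntervals {a b c : ℤ} (ha : a ≠ 0) (hb : b ≠ 0)
    (hc : c ≠ 0) (h : HasNegativeColorings a b c) : UncommonOverIntervals ![a, b, c] := by
  obtain ⟨K, m₀, hK, H⟩ := h
  have hKr : (1 : ℝ) ≤ K := by exact_mod_cast hK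
  have hδ : (0 : ℝ) < 1 / (8 * (K : ℝ) ^ 2) := by positivity
  refine uncommonOverIntervals_of_eventually (δ := 1 / (8 * (K : ℝ) ^ 2) / 4) (by positivity) ?_
  filter_upwards [eventually_ge_atTop (K * (m₀ + 1)), eventually_ge_atTop (24 * K ^ 2)]
    with n hn1 hn2
  have hm : m₀ + 1 ≤ n / K := (Nat.le_div_iff_mul_le hK).2 (by linarith)
  have hlt : n < K * (n / K + 1) := Nat.lt_mul_div_succ n hK
  obtain ⟨g, hg, hle⟩ := H (n / K) n (by omega) (Nat.mul_div_le n K) hlt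
  obtain ⟨G, hG⟩ := exists_units_quadForm_le (A := Finset.Icc 1 (n : ℤ)) (C := 3) (by norm_num)
    (fun x => tripleWeight_le_three a b c n x x) g hg
  have hn0 : 0 < n := lt_of_lt_of_le (by positivity) hn2
  refine (minMonoProportion_le _ _ _).trans (monoProportion_le ha hb hc hn0 G hδ ?_)
  have hcard : ((Finset.Icc 1 (n : ℤ)).card : ℤ) = n := by simp
  rw [hcard] at hG
  generalize n / K = m at *
  have hq : (quadForm (tripleWeight a b c n) (Finset.Icc 1 (n : ℤ)) (fun x => (G x : ℤ)) : ℝ)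
      ≤ -(m : ℝ) ^ 2 + 3 * n := by
    have := (Int.cast_le (R := ℝ)).2 (hG.trans (add_le_add_left hle _))
    push_cast at this
    exact this
  refine hq.trans ?_
  have hm1 : (1 : ℝ) ≤ m := by exact_mod_cast (by omega : 1 ≤ m)
  have hnm : (n : ℝ) ≤ 2 * K * m := by
    have : (n : ℝ) < K * (m + 1) := by exact_mod_cast hlt
    nlinarith
  have hn2r : 24 * (K : ℝ) ^ 2 ≤ n := by exact_mod_cast hn2
  have hsq : (n : ℝ) ^ 2 ≤ 4 * (K : ℝ) ^ 2 * (m : ℝ) ^ 2 := by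
    calc (n : ℝ) ^ 2 ≤ (2 * K * m) ^ 2 := pow_le_pow_left₀ (by positivity) hnm 2
      _ = _ := by ring
  have h24 : 24 * (K : ℝ) ^ 2 * n ≤ (n : ℝ) ^ 2 := by nlinarith
  have hK2 : (0 : ℝ) < 8 * (K : ℝ) ^ 2 := by positivity
  rw [neg_mul, one_div_mul_eq_div, le_neg, div_le_iff₀ hK2]
  nlinarith

theorem theorem1 (a b c : ℤ) (ha : a ≠ 0) (hb : b ≠ 0) (hc : c ≠ 0) :
    UncommonOverIntervals ![a, b, c] := by
  have pos (a b c : ℤ) (ha : 0 < a) (hb : 0 < b) (hc : 0 < c) (n : ℕ) :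
      solutions ![a, b, c] (Finset.Icc 1 (n : ℤ)) = ∅ :=
    solutions_eq_empty_of_pos (fun i => by fin_cases i <;> assumption) n
  rcases ha.lt_or_gt with ha' | ha'
  · by_cases h : 0 < b ∨ 0 < c
    · refine HasNegativeColorings.uncommonOverIntervals ha hb hc (hasNegativeColorings_neg.1 ?_)
      exact hasNegativeColorings_of_pos (neg_pos.2 ha') (neg_ne_zero.2 hb) (neg_ne_zero.2 hc)
        (by simpa using h)
    · push Not at h
      refine uncommonOverIntervals_of_solutions_eq_empty fun n => ?_
      rw [← solutions_neg]
      simpa using pos (-a) (-b) (-c) (neg_pos.2 ha') (neg_pos.2 (h.1.lt_of_ne hb))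
        (neg_pos.2 (h.2.lt_of_ne hc)) n
  · by_cases h : b < 0 ∨ c < 0
    · exact HasNegativeColorings.uncommonOverIntervals ha hb hc
        (hasNegativeColorings_of_pos ha' hb hc h)
    · push Not at h
      exact uncommonOverIntervals_of_solutions_eq_empty
        (pos a b c ha' (h.1.lt_of_ne hb.symm) (h.2.lt_of_ne hc.symm))
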